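/- **Setting.** Let $K$ be an algebraically closed field of characteristic zero. For a commutative $K$-algebra $R$, let $D^0(R)$ be the set of $P\in\operatorname{End}_K(R)$ with $Pr-rP=0$ for all $r\in R$, let $D^{k+1}(R)$ be the set of $P\in\operatorname{End}_K(R)$ with $Pr-rP\in D^k(R)$ for all $r\in R$ (elements of $R$ act by multiplication), and let $D(R)=\bigcup_{k\ge 0}D^k(R)$ be the ring of $K$-linear differential operators of $R$, with composition as multiplication. Let $A\subset\mathbb Z^d$ be a finite set that generates $\mathbb Z^d$ as a group and whose cone $\mathbb R_{\ge0}A\subseteq\mathbb R^d$ is strongly convex. Let $\mathbb NA$ be the monoid generated by $A$, let $K[\mathbb NA]$ be its semigroup algebra, and write $S=\mathbb NA$. A facet $\sigma$ is a face of $\mathbb R_{\ge0}A$ of codimension one in $\mathbb{R}^d$; its primitive integral support function $F_\sigma$ is the linear form on $\mathbb R^d$ with $F_\sigma\ge 0$ on $\mathbb R_{\ge0}A$, $F_\sigma=0$ on $\sigma$ and $F_\sigma(\mathbb Z^d)=\mathbb Z$. The scored closure of $S$ is $$S_c=\{a\in\mathbb Z^d : F_\sigma(a)\in F_\sigma(S)\text{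 for all facets }\sigma\}.$$ A standard expression of $S$ is an expression $$S=S_c\setminus\bigcup_{i=1}^m\bigl(b_i+\mathbb Z(A\cap\tau_i)\bigr)$$ with $b_i\in S_c$ and faces $\tau_i$ of $\mathbb R_{\ge0}A$, which is irredundant: no term of the union can be omitted. For a face $\tau$, $\mathbb{Z}(A\cap\tau)$ is the subgroup of $\mathbb{Z}^d$ generated by $A\cap\tau$, $K\tau$ is the $K$-linear span of $A\cap\tau$ in $K^d$, and $\operatorname{codim}\tau=d-\dim\tau$; $\tau\succ\tau'$ means that $\tau'$ is a proper face of $\tau$. **Theorem.** Let $S=\mathbb NA$ have the standard expression above, and let $j\in\{1,\dots,m\}$ be an index (by reordering one may take $j=m$) such that $\operatorname{codim}\tau_j>1$ and $$\bigcap_{\substack{\tau_i\succ\tau_j\\ b_i-b_j\in K\tau_i}}\tau_i\;\neq\;\tau_j ,$$ where an empty intersection is read as the whole space $\mathbb R^d$. Then $D(K[\mathbb NA])$ is not left Noetherian. -/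

import Mathlib

namespace SemigroupDiffOp

section DifferentialOperators

/-- The `K`-submodule `D^k(R)` of `End_K(R)` of Grothendieck differential operators of order
at most `k` on a commutative `K`-algebra `R`: `P` has order at most `0` iff `P r - r P = 0` for
all `r : R`, and order at most `k + 1` iff `P r - r P` has order at most `k` for all `r : R`. -/
noncomputable def diffOpOrder (K R : Type*) [Field K] [CommRing R] [Algebra K R] :
    ℕ → Submodule K (Module.End K R)
  | 0 =>
    { carrier := {P | ∀ r : R, P * LinearMap.mulLeft K r - LinearMap.mulLeft K r * P = 0}
      add_mem' := by
        intro P Q hP hQ r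
        have h : (P + Q) * LinearMap.mulLeft K r - LinearMap.mulLeft K r * (P + Q)
            = (P * LinearMap.mulLeft K r - LinearMap.mulLeft K r * P)
              + (Q * LinearMap.mulLeft K r - LinearMap.mulLeft K r * Q) := by noncomm_ring
        rw [h, hP r, hQ r, add_zero]
      zero_mem' := by intro r; simp
      smul_mem' := by
        intro c P hP r
        rw [smul_mul_assoc, mul_smul_comm, ← smul_sub, hP r, smul_zero] }
  | k + 1 =>
    { carrier := {P | ∀ r : R,
        P * LinearMap.mulLeft K r - LinearMap.mulLeft K r * P ∈ diffOpOrder K R k}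
      add_mem' := by
        intro P Q hP hQ r
        have h : (P + Q) * LinearMap.mulLeft K r - LinearMap.mulLeft K r * (P + Q)
            = (P * LinearMap.mulLeft K r - LinearMap.mulLeft K r * P)
              + (Q * LinearMap.mulLeft K r - LinearMap.mulLeft K r * Q) := by noncomm_ring
        rw [h]
        exact add_mem (hP r) (hQ r)
      zero_mem' := by intro r; simp
      smul_mem' := by
        intro c P hP r
        rw [smul_mul_assoc, mul_smul_comm, ← smul_sub]
        exact Submodule.smul_mem _ c (hP r) }

variable {K R : Type*} [Field K] [CommRing R] [Algebra K R]

theorem mem_diffOpOrder_zero {P : Module.End K R} :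
    P ∈ diffOpOrder K R 0 ↔
      ∀ r : R, P * LinearMap.mulLeft K r - LinearMap.mulLeft K r * P = 0 := Iff.rfl

theorem mem_diffOpOrder_succ {k : ℕ} {P : Module.End K R} :
    P ∈ diffOpOrder K R (k + 1) ↔
      ∀ r : R, P * LinearMap.mulLeft K r - LinearMap.mulLeft K r * P ∈ diffOpOrder K R k :=
  Iff.rfl

theorem diffOpOrder_le_succ (k : ℕ) : diffOpOrder K R k ≤ diffOpOrder K R (k + 1) := by
  induction k with
  | zero =>
    intro P hP r
    rw [mem_diffOpOrder_zero.1 hP r]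
    exact zero_mem _
  | succ k ih => exact fun P hP r => ih (hP r)

theorem diffOpOrder_mono : Monotone (diffOpOrder K R) :=
  monotone_nat_of_le_succ diffOpOrder_le_succ

theorem mul_mem_diffOpOrder : ∀ (N m n : ℕ), m + n = N → ∀ P Q : Module.End K R,
    P ∈ diffOpOrder K R m → Q ∈ diffOpOrder K R n → P * Q ∈ diffOpOrder K R N := by
  intro N
  induction N with
  | zero =>
    intro m n h P Q hP hQ r
    obtain ⟨rfl, rfl⟩ : m = 0 ∧ n = 0 := by omega
    have e : P * Q * LinearMap.mulLeft K r - LinearMap.mulLeft K r * (P * Q)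
        = P * (Q * LinearMap.mulLeft K r - LinearMap.mulLeft K r * Q)
          + (P * LinearMap.mulLeft K r - LinearMap.mulLeft K r * P) * Q := by
      simp only [mul_sub, sub_mul, mul_assoc]
      abel
    rw [e, hP r, hQ r, mul_zero, zero_mul, add_zero]
  | succ N ih =>
    intro m n h P Q hP hQ r
    have e : P * Q * LinearMap.mulLeft K r - LinearMap.mulLeft K r * (P * Q)
        = P * (Q * LinearMap.mulLeft K r - LinearMap.mulLeft K r * Q)
          + (P * LinearMap.mulLeft K r - LinearMap.mulLeft K r * P) * Q := by
      simp only [mul_sub, sub_mul, mul_assoc]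
      abel
    rw [e]
    refine add_mem ?_ ?_
    · cases n with
      | zero => rw [mem_diffOpOrder_zero.1 hQ r, mul_zero]; exact zero_mem _
      | succ n => exact ih m n (by omega) _ _ hP (hQ r)
    · cases m with
      | zero => rw [mem_diffOpOrder_zero.1 hP r, zero_mul]; exact zero_mem _
      | succ m => exact ih m n (by omega) _ _ (hP r) hQ

theorem algebraMap_mem_diffOpOrder (c : K) :
    algebraMap K (Module.End K R) c ∈ diffOpOrder K R 0 := by
  intro r
  rw [Algebra.commutes, sub_self]

/-- The ring `D(R)` of `K`-linear differential operators of `R`, a subalgebra of `End_K(R)`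
(multiplication is composition). -/
noncomputable def diffOp (K R : Type*) [Field K] [CommRing R] [Algebra K R] :
    Subalgebra K (Module.End K R) where
  carrier := {P | ∃ k : ℕ, P ∈ diffOpOrder K R k}
  mul_mem' := by
    rintro P Q ⟨m, hP⟩ ⟨n, hQ⟩
    exact ⟨m + n, mul_mem_diffOpOrder _ m n rfl P Q hP hQ⟩
  add_mem' := by
    rintro P Q ⟨m, hP⟩ ⟨n, hQ⟩
    exact ⟨max m n, add_mem (diffOpOrder_mono (le_max_left m n) hP)
      (diffOpOrder_mono (le_max_right m n) hQ)⟩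
  algebraMap_mem' := fun c => ⟨0, algebraMap_mem_diffOpOrder c⟩

end DifferentialOperators

/-- The image of an integer vector in `k^d`. -/
def castVec (k : Type*) [Ring k] {d : ℕ} (z : Fin d → ℤ) : Fin d → k := fun i => (z i : k)

section Cones

variable {d : ℕ}

/-- The cone `ℝ_{≥0} A` in `ℝ^d`. -/
noncomputable def cone (A : Finset (Fin d → ℤ)) : PointedCone ℝ (Fin d → ℝ) :=
  PointedCone.hull ℝ (castVec ℝ '' (A : Set (Fin d → ℤ)))

/-- Codimension of a cone in `ℝ^d`. -/
noncomputable def codim (τ : PointedCone ℝ (Fin d → ℝ)) : ℕ :=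
  d - Module.finrank ℝ (Submodule.span ℝ (τ : Set (Fin d → ℝ)))

/-- Facets of `ℝ_{≥0} A`: faces of codimension one. -/
def IsFacet (A : Finset (Fin d → ℤ)) (σ : PointedCone ℝ (Fin d → ℝ)) : Prop :=
  σ.IsFaceOf (cone A) ∧ codim σ = 1

/-- `F` is the primitive integral support function `F_σ` of `σ`: it is nonnegative on
`ℝ_{≥0} A`, zero on `σ`, and maps `ℤ^d` onto `ℤ`. -/
structure IsPrimitiveSupport (A : Finset (Fin d → ℤ)) (σ : PointedCone ℝ (Fin d → ℝ))
    (F : (Fin d → ℝ) →ₗ[ℝ] ℝ) : Prop where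
  nonneg : ∀ x ∈ cone A, 0 ≤ F x
  zero : ∀ x ∈ σ, F x = 0
  image : Set.range (fun z : Fin d → ℤ => F (castVec ℝ z)) = Set.range (fun n : ℤ => (n : ℝ))

/-- The scored closure of `S ⊆ ℤ^d`: all `a ∈ ℤ^d` with `F_σ(a) ∈ F_σ(S)` for all facets `σ` of
`ℝ_{≥0} A`. -/
def scoredClosure (A : Finset (Fin d → ℤ)) (S : Set (Fin d → ℤ)) : Set (Fin d → ℤ) :=
  {a | ∀ σ, IsFacet A σ → ∀ F, IsPrimitiveSupport A σ F →
    F (castVec ℝ a) ∈ (fun s => F (castVec ℝ s)) '' S}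

/-- `A ∩ τ`. -/
def restrict (A : Finset (Fin d → ℤ)) (τ : PointedCone ℝ (Fin d → ℝ)) : Set (Fin d → ℤ) :=
  {a | a ∈ A ∧ castVec ℝ a ∈ τ}

/-- The coset `b + ℤ(A ∩ τ)`. -/
def faceCoset (A : Finset (Fin d → ℤ)) (b : Fin d → ℤ) (τ : PointedCone ℝ (Fin d → ℝ)) :
    Set (Fin d → ℤ) :=
  {a | a - b ∈ AddSubgroup.closure (restrict A τ)}

/-- `K τ`, the `K`-subspace of `K^d` spanned by `A ∩ τ`. -/
def faceSpan (K : Type*) [Field K] (A : Finset (Fin d → ℤ)) (τ : PointedCone ℝ (Fin d → ℝ)) :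
    Submodule K (Fin d → K) :=
  Submodule.span K (castVec K '' restrict A τ)

/-- `S = S_c ∖ ⋃ i, (b i + ℤ(A ∩ τ i))`, where `S_c` is the scored closure of `S`, is a standard
expression of `S`: the `τ i` are faces of `ℝ_{≥0} A`, the `b i` lie in `S_c`, and none of the
cosets can be omitted. -/
structure IsStandardExpression (A : Finset (Fin d → ℤ)) (S : Set (Fin d → ℤ)) {m : ℕ}
    (b : Fin m → (Fin d → ℤ)) (τ : Fin m → PointedCone ℝ (Fin d → ℝ)) : Prop where
  isFace : ∀ i, (τ i).IsFaceOf (cone A)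
  mem_scoredClosure : ∀ i, b i ∈ scoredClosure A S
  eq_diff : S = scoredClosure A S \ ⋃ i, faceCoset A (b i) (τ i)
  irredundant : ∀ j, S ≠ scoredClosure A S \ ⋃ i, ⋃ (_ : i ≠ j), faceCoset A (b i) (τ i)

end Cones

end SemigroupDiffOp

/-! A differential operator of `K[S]` has coefficients that are polynomial in the exponent. Fix a
hole `h ∉ S` in the coset of `b j`, let `w` be the sum of all generators, and let `x n` be a sparse
sequence on the ray in direction of a generator `c`, shifted by `-w`. Take homogeneous operators `P
n = t^(h - x n) p n (θ)` with `p n (x n) ≠ 0`. If `P n = ∑ Q k * P k` over `k < n`, then comparing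
coefficients at `t^(h + N w)` after applying both sides to `t^(x n + N w)` gives an identity
polynomial in `N`, valid for `N ≥ 1` and hence for `N = 0`. There every `Q k` contributes a
coefficient at the exponent `h`, which is zero because `h ∉ S`. So `p n (x n) = 0`, a contradiction,
and the left ideal of the `P n` is not finitely generated. This is the criterion
`not_isNoetherianRing_diffOp` of the section on graded operators.

The geometry must supply `h + (n - k)(M + 1) c ∈ S` and the polynomials `p n`. The generator `c`
lies outside `τ j`, but in each relevant larger face `τ i` (`exists_generator`); `h` is chosen so
that it meets `b i + K τ i` only when `τ j ≤ τ i` (`exists_generic_hole`). Irredundancy then makes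
the ray from `h` in direction `c` enter `S` for good. The polynomial `p n` must vanish where `t^(h -
x n)` leads out of `S`, but not at `x n` (`isPolySeparated_of_support`). The only dangerous cosets
are those with `h ∈ b i + K τ i`; for these a supporting functional of `τ i` that kills `c` is
negative at `x n`, so no point of `S` is led into them. -/

namespace SemigroupDiffOp

/-! ### Polynomial functions on commutative monoids, via iterated differences -/

section PolynomialFunctions

variable {K : Type*} [CommRing K]

/-- `IsPolyFun n f`: all `n`-fold iterated differences of `f` vanish, i.e. `f` is a polynomial
function of degree less than `n`. -/
def IsPolyFun {M : Type*} [Add M] : ℕ → (M → K) → Prop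
  | 0, f => f = 0
  | n + 1, f => ∀ r, IsPolyFun n (fun x => f (x + r) - f x)

namespace IsPolyFun

variable {M N : Type*} [AddCommMonoid M] [AddCommMonoid N]

theorem zero (n : ℕ) : IsPolyFun n (0 : M → K) := by
  induction n with
  | zero => rfl
  | succ n ih =>
    intro r
    convert ih using 1
    ext x; simp

theorem succ {n : ℕ} {f : M → K} (hf : IsPolyFun n f) : IsPolyFun (n + 1) f := by
  induction n generalizing f with
  | zero => obtain rfl := hf; exact zero 1
  | succ n ih => exact fun r => ih (hf r)

theorem mono {m n : ℕ} (h : m ≤ n) {f : M → K} (hf : IsPolyFun m f) : IsPolyFun n f := by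
  induction n, h using Nat.le_induction with
  | base => exact hf
  | succ n _ ih => exact ih.succ

theorem add {n : ℕ} {f g : M → K} (hf : IsPolyFun n f) (hg : IsPolyFun n g) :
    IsPolyFun n (f + g) := by
  induction n generalizing f g with
  | zero => rw [show f = 0 from hf, show g = 0 from hg, add_zero]; rfl
  | succ n ih =>
    intro r
    convert ih (hf r) (hg r) using 1
    ext x; simp only [Pi.add_apply]; ring

theorem neg {n : ℕ} {f : M → K} (hf : IsPolyFun n f) : IsPolyFun n (-f) := by
  induction n generalizing f with
  | zero => rw [show f = 0 from hf, neg_zero]; rfl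
  | succ n ih =>
    intro r
    convert ih (hf r) using 1
    ext x; simp only [Pi.neg_apply]; ring

/-- Pulling back along a map which intertwines translations. -/
theorem comp {n : ℕ} {f : M → K} (hf : IsPolyFun n f) (g : N → M) (h : N → M)
    (hg : ∀ x r, g (x + r) = g x + h r) : IsPolyFun n (f ∘ g) := by
  induction n generalizing f with
  | zero => obtain rfl := hf; exact zero 0
  | succ n ih =>
    intro r
    convert ih (hf (h r)) using 1
    ext x; simp [hg]

theorem mul {m n : ℕ} {f g : M → K} (hf : IsPolyFun m f) (hg : IsPolyFun n g) :
    IsPolyFun (m + n) (f * g) := by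
  induction hk : m + n generalizing m n f g with
  | zero =>
    obtain ⟨rfl, rfl⟩ : m = 0 ∧ n = 0 := by omega
    obtain rfl := hf
    simpa using zero (K := K) (M := M) 0
  | succ k ih =>
    rcases m with - | m
    · obtain rfl := hf
      simpa using zero (K := K) (M := M) (k + 1)
    rcases n with - | n
    · obtain rfl := hg
      simpa using zero (K := K) (M := M) (k + 1)
    intro r
    have h1 := ih (hf r) (hg.comp (· + r) id fun x s => by simp only [id]; abel) (by omega)
    have h2 := ih hf (hg r) (by omega)
    convert h1.add h2 using 1
    ext x; simp only [Pi.mul_apply, Pi.add_apply, Function.comp_apply]; ring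

theorem sum {ι : Type*} {n : ℕ} (s : Finset ι) (f : ι → M → K)
    (hf : ∀ i ∈ s, IsPolyFun n (f i)) : IsPolyFun n (∑ i ∈ s, f i) :=
  Finset.sum_induction f _ (fun _ _ => add) (zero n) hf

theorem const (c : K) : IsPolyFun 1 (fun _ : M => c) := by
  intro r; funext x; simp

theorem affine (f : M →+ K) (c : K) : IsPolyFun 2 (fun x => f x + c) := by
  intro r
  convert const (M := M) (f r) using 2
  simp only [map_add]; ring

theorem exists_prod {ι : Type*} (s : Finset ι) (f : ι → M → K)
    (hf : ∀ i ∈ s, ∃ n, IsPolyFun n (f i)) : ∃ n, IsPolyFun n (∏ i ∈ s, f i) :=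
  Finset.prod_induction f (fun g => ∃ n, IsPolyFun n g)
    (fun _ _ ⟨m, hm⟩ ⟨n, hn⟩ => ⟨m + n, hm.mul hn⟩) ⟨1, const 1⟩ hf

/-- A polynomial function on `ℕ` that vanishes at all positive numbers vanishes. -/
theorem eq_zero_of_forall_succ {n : ℕ} {f : ℕ → K} (hf : IsPolyFun n f)
    (h : ∀ N, f (N + 1) = 0) : f = 0 := by
  induction n generalizing f with
  | zero => exact hf
  | succ n ih =>
    -- The first difference also vanishes at positive arguments, so by induction it vanishes at `0`,
    -- and `f 0 = f 1`.
    have h0 := congrFun (ih (hf 1) fun N => by simp [h]) 0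
    funext N
    rcases N with - | N
    · simpa [h 0] using h0
    · exact h N

end IsPolyFun

end PolynomialFunctions

/-! ### Homogeneous operators on `K[S]` and the criterion for failure of the left Noetherian
property -/

section GradedOperators

open AddMonoidAlgebra

variable {K G : Type*} [Field K] [AddCommGroup G]

open Classical in
/-- The operator `t^a φ(θ)` on `K[S]`: it sends `t^s` to `φ(s) t^(s+a)` if `s + a ∈ S`, and to `0`
otherwise. -/
noncomputable def gradedOp (S : AddSubmonoid G) (a : G) (φ : G → K) :
    Module.End K (AddMonoidAlgebra K S) :=
  Finsupp.linearCombination K (fun s : S =>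
    if h : (s : G) + a ∈ S then (single ⟨s + a, h⟩ (φ s) : AddMonoidAlgebra K S) else 0) ∘ₗ
    (coeffLinearEquiv K).toLinearMap

open Classical in
/-- The coefficient of `t^g` in an element of `K[S]`, where `g` may lie outside of `S`. -/
noncomputable def coeffAt (S : AddSubmonoid G) (g : G) : AddMonoidAlgebra K S →ₗ[K] K :=
  if h : g ∈ S then Finsupp.lapply ⟨g, h⟩ ∘ₗ (coeffLinearEquiv K).toLinearMap else 0

variable {S : AddSubmonoid G}

theorem gradedOp_single_of_mem {a : G} (φ : G → K) {s : S} (h : (s : G) + a ∈ S) (c : K) :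
    gradedOp S a φ (single s c) = single ⟨s + a, h⟩ (c * φ s) := by
  simp [gradedOp, h, coeffLinearEquiv]

theorem gradedOp_single_of_notMem {a : G} (φ : G → K) {s : S} (h : (s : G) + a ∉ S) (c : K) :
    gradedOp S a φ (single s c) = 0 := by
  simp [gradedOp, h, coeffLinearEquiv]

theorem coeffAt_of_mem {g : G} (h : g ∈ S) (x : AddMonoidAlgebra K S) :
    coeffAt S g x = x.coeff ⟨g, h⟩ := by
  simp [coeffAt, h, coeffLinearEquiv]

theorem coeffAt_of_notMem {g : G} (h : g ∉ S) (x : AddMonoidAlgebra K S) :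
    coeffAt S g x = 0 := by
  simp [coeffAt, h]

theorem coeffAt_single_mul (g : G) (r : S) (x : AddMonoidAlgebra K S) :
    coeffAt S (g + r) (single r 1 * x) = coeffAt S g x := by
  by_cases hg : g ∈ S
  · have h : g + r ∈ S := S.add_mem hg r.2
    rw [coeffAt_of_mem h, coeffAt_of_mem hg]
    have e : (⟨g + r, h⟩ : S) = r + ⟨g, hg⟩ := Subtype.ext (add_comm _ _)
    rw [e, coeff_single_mul_add, one_mul]
  · rw [coeffAt_of_notMem hg]
    by_cases h : g + r ∈ S
    · rw [coeffAt_of_mem h]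
      refine coeff_single_mul_of_forall_add_ne _ _ fun d hd => hg ?_
      have : (r : G) + d = g + r := congrArg Subtype.val hd
      rw [add_comm, add_right_cancel_iff] at this
      exact this ▸ d.2
    · rw [coeffAt_of_notMem h]

/-- Commuting with `t^r` differences `φ`, which turns operator order into polynomial degree. The
vanishing hypothesis is needed when `s + a ∉ S` but `s + a + r ∈ S`: there the truncation of the
operator must agree with the formula. -/
theorem gradedOp_commutator {a : G} {φ : G → K} (hφ : ∀ s ∈ S, s + a ∉ S → φ s = 0) (r : S) :
    gradedOp S a φ * LinearMap.mulLeft K (single r 1)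
      - LinearMap.mulLeft K (single r 1) * gradedOp S a φ
      = gradedOp S (a + r) (fun x => φ (x + r) - φ x) := by
  refine lhom_ext' fun s => LinearMap.ext_ring ?_
  simp only [LinearMap.comp_apply, LinearMap.sub_apply, Module.End.mul_apply, lsingle_apply,
    LinearMap.mulLeft_apply, single_mul_single, one_mul]
  by_cases h1 : (s : G) + (a + r) ∈ S
  · have h2 : ((r + s : S) : G) + a ∈ S := by
      convert h1 using 1; push_cast; abel
    rw [gradedOp_single_of_mem _ h1, gradedOp_single_of_mem _ h2]
    have e : (⟨_, h2⟩ : S) = ⟨_, h1⟩ := Subtype.ext (by push_cast; abel)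
    rw [e, AddSubmonoid.coe_add, add_comm (r : G)]
    by_cases h3 : (s : G) + a ∈ S
    · have e' : r + (⟨_, h3⟩ : S) = ⟨_, h1⟩ := Subtype.ext (by push_cast; abel)
      rw [gradedOp_single_of_mem _ h3, single_mul_single, e', ← single_sub]
      simp
    · rw [gradedOp_single_of_notMem _ h3, hφ s s.2 h3]
      simp
  · have h2 : ((r + s : S) : G) + a ∉ S := by
      rwa [AddSubmonoid.coe_add, add_comm (r : G), add_assoc, add_comm (r : G)]
    have h3 : (s : G) + a ∉ S := fun h => h1 (by
      rw [← add_assoc]; exact S.add_mem h r.2)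
    rw [gradedOp_single_of_notMem _ h1, gradedOp_single_of_notMem _ h2,
      gradedOp_single_of_notMem _ h3, mul_zero, sub_zero]

/-- Operators whose commutators with all `t^r` lie in a subspace have all commutators in it. -/
theorem commutator_mem_of_single {P : Module.End K (AddMonoidAlgebra K S)}
    {V : Submodule K (Module.End K (AddMonoidAlgebra K S))}
    (h : ∀ r : S, P * LinearMap.mulLeft K (single r 1) - LinearMap.mulLeft K (single r 1) * P ∈ V)
    (x : AddMonoidAlgebra K S) :
    P * LinearMap.mulLeft K x - LinearMap.mulLeft K x * P ∈ V := by
  have key : ∀ y : AddMonoidAlgebra K S, P * LinearMap.mulLeft K y - LinearMap.mulLeft K y * P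
      = (LinearMap.mulLeft K P - LinearMap.mulRight K P) (LinearMap.mul K _ y) := fun y => rfl
  induction x using AddMonoidAlgebra.induction_linear with
  | zero => rw [key]; simp
  | add f g hf hg => rw [key] at *; rw [map_add, map_add]; exact V.add_mem hf hg
  | single r c =>
    have e : (single r c : AddMonoidAlgebra K S) = c • single r 1 := by simp
    rw [e, key, map_smul, map_smul]
    exact V.smul_mem c (h r)

theorem gradedOp_mem_diffOpOrder {n : ℕ} {a : G} {φ : G → K} (hn : IsPolyFun (n + 1) φ)
    (hφ : ∀ s ∈ S, s + a ∉ S → φ s = 0) :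
    gradedOp S a φ ∈ diffOpOrder K (AddMonoidAlgebra K S) n := by
  induction n generalizing a φ with
  | zero =>
    intro x
    rw [← Submodule.mem_bot K]
    refine commutator_mem_of_single (fun r => ?_) x
    rw [gradedOp_commutator hφ, hn (r : G), Submodule.mem_bot]
    refine lhom_ext' fun s => LinearMap.ext_ring ?_
    by_cases h : (s : G) + (a + r) ∈ S
    · simp [gradedOp_single_of_mem _ h]
    · simp [gradedOp_single_of_notMem _ h]
  | succ n ih =>
    refine commutator_mem_of_single fun r => ?_
    rw [gradedOp_commutator hφ]
    refine ih (hn (r : G)) fun s hs h => ?_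
    rw [hφ (s + r) (S.add_mem hs r.2) (by rwa [add_assoc, add_comm (r : G)]),
      hφ s hs fun h' => h (by rw [← add_assoc]; exact S.add_mem h' r.2), sub_zero]

theorem coeffAt_commutator (Q : Module.End K (AddMonoidAlgebra K S)) (a : G) (r s : S) :
    coeffAt S (((s + r : S) : G) + a) (Q (single (s + r) 1)) - coeffAt S (s + a) (Q (single s 1))
      = coeffAt S (s + (r + a)) ((Q * LinearMap.mulLeft K (single r 1)
        - LinearMap.mulLeft K (single r 1) * Q : Module.End K (AddMonoidAlgebra K S))
        (single s 1)) := by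
  have e : (s : G) + (r + a) = s + a + r := by abel
  rw [LinearMap.sub_apply, map_sub, Module.End.mul_apply, Module.End.mul_apply,
    LinearMap.mulLeft_apply, LinearMap.mulLeft_apply, e, coeffAt_single_mul, single_mul_single,
    one_mul, add_comm r s, AddSubmonoid.coe_add, add_right_comm]

/-- A difference of the coefficient function in direction `r` is a coefficient function of the
commutator with `t^r`, so each step down in order costs one difference. The exponent `s + a` may
leave `S`, where the coefficient is read as zero; polynomiality persists across such points, and the
criterion depends on this. -/
theorem isPolyFun_coeffAt {n : ℕ} {Q : Module.End K (AddMonoidAlgebra K S)}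
    (hQ : Q ∈ diffOpOrder K (AddMonoidAlgebra K S) n) (a : G) :
    IsPolyFun (n + 1) (fun s : S => coeffAt S (s + a) (Q (single s 1))) := by
  induction n generalizing Q a with
  | zero =>
    intro r
    funext s
    rw [coeffAt_commutator, mem_diffOpOrder_zero.1 hQ]
    simp
  | succ n ih =>
    intro r
    simp only [coeffAt_commutator]
    exact ih (hQ (single r 1)) (r + a)

theorem exists_isPolyFun_coeffAt {Q : Module.End K (AddMonoidAlgebra K S)}
    (hQ : Q ∈ diffOp K (AddMonoidAlgebra K S)) {u w : G} (hu : u ∈ S) (hw : w ∈ S) (a : G) :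
    ∃ n, IsPolyFun n (fun N : ℕ => coeffAt S (u + N • w + a)
      (Q (single ⟨u + N • w, S.add_mem hu (S.nsmul_mem hw N)⟩ 1))) := by
  obtain ⟨n, hn⟩ := hQ
  exact ⟨n + 1, (isPolyFun_coeffAt hn a).comp
    (fun N : ℕ => (⟨u + N • w, S.add_mem hu (S.nsmul_mem hw N)⟩ : S))
    (fun N => ⟨N • w, S.nsmul_mem hw N⟩)
    fun N r => Subtype.ext (by simp [add_smul, add_assoc])⟩

/-- A criterion for `D(K[S])` not to be left Noetherian: the left ideal generated by suitable
homogeneous operators `t^(b - x n) p n (θ)` is not finitely generated. -/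
theorem not_isNoetherianRing_diffOp {b w : G} (x : ℕ → G) (hb : b ∉ S) (hw : w ∈ S)
    (hx : ∀ n, x n + w ∈ S) (hxx : ∀ k n, k < n → b + x n - x k ∈ S) (p : ℕ → G → K)
    (hp : ∀ n, ∃ k, IsPolyFun k (p n))
    (hvan : ∀ n, ∀ s ∈ S, s + (b - x n) ∉ S → p n s = 0) (hne : ∀ n, p n (x n) ≠ 0) :
    ¬ IsNoetherianRing (diffOp K (AddMonoidAlgebra K S)) := by
  intro hN
  let P : ℕ → diffOp K (AddMonoidAlgebra K S) := fun n =>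
    ⟨gradedOp S (b - x n) (p n), by
      obtain ⟨k, hk⟩ := hp n
      exact ⟨k, gradedOp_mem_diffOpOrder hk.succ (hvan n)⟩⟩
  obtain ⟨n, hn⟩ := monotone_stabilizes_iff_noetherian.2 hN
    ⟨fun n => Submodule.span _ (Set.range fun k : Fin n => P k), fun m n hmn =>
      Submodule.span_mono (Set.range_subset_iff.2 fun k => ⟨Fin.castLE hmn k, rfl⟩)⟩
  have hmem : P n ∈ Submodule.span (diffOp K (AddMonoidAlgebra K S))
      (Set.range fun k : Fin n => P k) := by
    have := hn (n + 1) n.le_succ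
    change Submodule.span _ _ = Submodule.span _ _ at this
    rw [this]
    exact Submodule.subset_span ⟨Fin.last n, rfl⟩
  obtain ⟨Q, hQ⟩ := (Submodule.mem_span_range_iff_exists_fun _).1 hmem
  have hQ' : gradedOp S (b - x n) (p n)
      = ∑ k : Fin n, (Q k : Module.End K (AddMonoidAlgebra K S))
        * gradedOp S (b - x k) (p k) := by
    have := congrArg Subtype.val hQ
    simp only [smul_eq_mul, AddSubmonoidClass.coe_finsetSum, MulMemClass.coe_mul] at this
    exact this.symm
  have hu (k : Fin n) : b + x n - x k ∈ S := hxx k n k.2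
  have hline (N : ℕ) : x n + (N + 1) • w ∈ S := by
    rw [add_smul, one_smul, add_left_comm]
    exact S.add_mem (S.nsmul_mem hw N) (hx n)
  -- `f k N` is the coefficient of `t^(b + N w)` in `Q k` applied to `t^(b + x n - x k + N w)`.
  let f : Fin n → ℕ → K := fun k N => coeffAt S (b + x n - x k + N • w + (x k - x n))
    ((Q k : Module.End K (AddMonoidAlgebra K S))
      (single ⟨b + x n - x k + N • w, S.add_mem (hu k) (S.nsmul_mem hw N)⟩ 1))
  have hpoly (m : ℕ) : ∃ d, IsPolyFun d (fun N : ℕ => p m (x n + N • w)) := by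
    obtain ⟨d, hd⟩ := hp m
    exact ⟨d, hd.comp (fun N : ℕ => x n + N • w) (fun N => N • w)
      fun N r => by rw [add_smul, add_assoc]⟩
  have hf (k : Fin n) : ∃ d, IsPolyFun d (f k) :=
    exists_isPolyFun_coeffAt (Q k).2 (hu k) hw _
  choose d hd using hpoly
  choose e he using hf
  obtain ⟨D, hD⟩ : ∃ D, ∀ k : Fin n, d k + e k ≤ D :=
    ⟨∑ k : Fin n, (d k + e k), fun k =>
      Finset.single_le_sum (f := fun k : Fin n => d k + e k) (fun _ _ => Nat.zero_le _)
        (Finset.mem_univ k)⟩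
  have htot := ((hd n).mono (le_max_left _ D)).add
    (IsPolyFun.sum Finset.univ _ fun (k : Fin n) _ =>
      ((hd k).mul (he k)).mono ((hD k).trans (le_max_right (d n) D))).neg
  -- The operator identity is tested only at `N + 1`, since `x n` itself need not lie in `S`;
  -- polynomiality carries the resulting identity to `0`.
  have hzero := congrFun (htot.eq_zero_of_forall_succ fun N => ?_) 0
  · simp only [Pi.add_apply, Pi.neg_apply, Finset.sum_apply, Pi.mul_apply, Pi.zero_apply, zero_smul,
      add_zero] at hzero
    rw [Finset.sum_eq_zero fun k _ => ?_, neg_zero, add_zero] at hzero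
    · exact hne n hzero
    -- At `N = 0` the exponent being read is `b`, a hole of `S`.
    · have : b + x n - x k + (0 : ℕ) • w + (x k - x n) ∉ S := by
        convert hb using 2; rw [zero_smul]; abel
      simp only [f, coeffAt_of_notMem this, mul_zero]
  · have key := congrArg (coeffAt S (b + (N + 1) • w))
      (LinearMap.congr_fun hQ' (single ⟨_, hline N⟩ 1))
    have coeff_single (s : S) (c : K) : coeffAt S (s : G) (single s c) = c := by
      rw [coeffAt_of_mem s.2]; simp
    simp only [Pi.add_apply, Pi.neg_apply, Finset.sum_apply, Pi.mul_apply]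
    rw [← sub_eq_add_neg, sub_eq_zero]
    have lhs : coeffAt S (b + (N + 1) • w)
        (gradedOp S (b - x n) (p n) (single ⟨_, hline N⟩ 1)) = p n (x n + (N + 1) • w) := by
      have e1 : x n + (N + 1) • w + (b - x n) = b + (N + 1) • w := by abel
      -- If the target exponent is outside `S`, both sides are zero by `hvan`.
      by_cases h : x n + (N + 1) • w + (b - x n) ∈ S
      · rw [gradedOp_single_of_mem (s := ⟨_, hline N⟩) _ h, ← e1,
          coeff_single ⟨_, h⟩, one_mul]
      · rw [← e1, coeffAt_of_notMem h, hvan n _ (hline N) h]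
    rw [← lhs, key, LinearMap.sum_apply, map_sum]
    refine Finset.sum_congr rfl fun k _ => ?_
    have e2 : x n + (N + 1) • w + (b - x k) = b + x n - x k + (N + 1) • w := by abel
    have e3 : b + x n - x k + (N + 1) • w + (x k - x n) = b + (N + 1) • w := by abel
    have h : x n + (N + 1) • w + (b - x k) ∈ S :=
      e2 ▸ S.add_mem (hu k) (S.nsmul_mem hw _)
    rw [Module.End.mul_apply, gradedOp_single_of_mem (s := ⟨_, hline N⟩) _ h]
    have e4 : (single ⟨_, h⟩ (1 * p k (x n + (N + 1) • w)) : AddMonoidAlgebra K S)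
        = p k (x n + (N + 1) • w) •
          single ⟨b + x n - x k + (N + 1) • w, S.add_mem (hu k) (S.nsmul_mem hw _)⟩ 1 := by
      rw [smul_single', mul_one, one_mul]
      congr 1
      exact Subtype.ext e2
    simp only [f, e3]
    rw [e4, map_smul, map_smul, smul_eq_mul]

end GradedOperators

/-! ### Integer vectors over different fields, and numerical semigroups -/

section IntegerVectors

variable {d : ℕ}

/-- `castVec` as an additive homomorphism. -/
def castVecHom (k : Type*) [Ring k] (d : ℕ) : (Fin d → ℤ) →+ (Fin d → k) where
  toFun := castVec k
  map_zero' := by ext; simp [castVec]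
  map_add' x y := by ext; simp [castVec]

@[simp] theorem castVecHom_apply (k : Type*) [Ring k] (z : Fin d → ℤ) :
    castVecHom k d z = castVec k z := rfl

theorem castVec_mem_span_of_mem_closure (k : Type*) [Ring k] {B : Set (Fin d → ℤ)}
    {z : Fin d → ℤ} (hz : z ∈ AddSubgroup.closure B) :
    castVec k z ∈ Submodule.span k (castVec k '' B) := by
  have : AddSubgroup.closure B
      ≤ (Submodule.span k (castVec k '' B)).toAddSubgroup.comap (castVecHom k d) :=
    (AddSubgroup.closure_le _).2 fun a ha => Submodule.subset_span ⟨a, ha, rfl⟩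
  exact this hz

/-- Linear dependence among integer vectors is already decided over `ℚ`: a rational functional
separating `z` from `B` would also separate over `K`. This transfers conditions on `K τ` to the real
cone. -/
theorem castVec_mem_span_of_charZero (K L : Type*) [Field K] [CharZero K] [Field L] [CharZero L]
    {B : Set (Fin d → ℤ)} {z : Fin d → ℤ} (hz : castVec K z ∈ Submodule.span K (castVec K '' B)) :
    castVec L z ∈ Submodule.span L (castVec L '' B) := by
  have hQ : castVec ℚ z ∈ Submodule.span ℚ (castVec ℚ '' B) := by
    by_contra h
    obtain ⟨f, hf, hB⟩ := Submodule.exists_le_ker_of_notMem h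
    let g : (Fin d → K) →ₗ[K] K :=
      ∑ i, ((f (Pi.single i 1) : ℚ) : K) • LinearMap.proj (R := K) (φ := fun _ : Fin d => K) i
    have hg (y : Fin d → ℤ) : g (castVec K y) = ((f (castVec ℚ y) : ℚ) : K) := by
      have e : castVec ℚ y = ∑ i, (y i : ℚ) • (Pi.single i 1 : Fin d → ℚ) := by
        ext i; simp [castVec, Finset.sum_apply, Pi.single_apply]
      rw [e, map_sum]
      simp [g, castVec, mul_comm]
    have hle : Submodule.span K (castVec K '' B) ≤ LinearMap.ker g := by
      refine Submodule.span_le.2 ?_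
      rintro _ ⟨y, hy, rfl⟩
      have : f (castVec ℚ y) = 0 := hB (Submodule.subset_span ⟨y, hy, rfl⟩)
      simp [hg, this]
    have := hle hz
    rw [LinearMap.mem_ker, hg, Rat.cast_eq_zero] at this
    exact hf this
  let J : (Fin d → ℚ) →ₗ[ℚ] (Fin d → L) := (Algebra.linearMap ℚ L).compLeft (Fin d)
  have hJ (y : Fin d → ℤ) : J (castVec ℚ y) = castVec L y := by
    ext i; simp [J, castVec]
  have h := Submodule.mem_map_of_mem (f := J) hQ
  rw [Submodule.map_span, hJ, ← Set.image_comp, show J ∘ castVec ℚ = castVec L from funext hJ] at h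
  exact Submodule.span_le_restrictScalars ℚ L _ h

theorem span_castVec_eq_top (k : Type*) [Ring k] {B : Set (Fin d → ℤ)}
    (hB : AddSubgroup.closure B = ⊤) : Submodule.span k (castVec k '' B) = ⊤ := by
  rw [eq_top_iff]
  intro x _
  have e : x = ∑ i, x i • castVec k (Pi.single i 1) := by
    ext i
    simp [castVec, Finset.sum_apply, Pi.single_apply]
  rw [e]
  exact Submodule.sum_mem _ fun i _ => Submodule.smul_mem _ _
    (castVec_mem_span_of_mem_closure k (hB ▸ AddSubgroup.mem_top _))

end IntegerVectors

theorem exists_sub_of_closure_eq_top {G : Type*} [AddCommGroup G] {B : Set G}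
    (hB : AddSubgroup.closure B = ⊤) (g : G) :
    ∃ s ∈ AddSubmonoid.closure B, ∃ t ∈ AddSubmonoid.closure B, g = s - t := by
  have hg : g ∈ AddSubgroup.closure B := hB ▸ AddSubgroup.mem_top g
  induction hg using AddSubgroup.closure_induction with
  | mem x hx => exact ⟨x, AddSubmonoid.subset_closure hx, 0, zero_mem _, by simp⟩
  | zero => exact ⟨0, zero_mem _, 0, zero_mem _, by simp⟩
  | add x y _ _ hx hy =>
    obtain ⟨s, hs, t, ht, rfl⟩ := hx
    obtain ⟨s', hs', t', ht', rfl⟩ := hy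
    exact ⟨s + s', add_mem hs hs', t + t', add_mem ht ht', by abel⟩
  | neg x _ hx =>
    obtain ⟨s, hs, t, ht, rfl⟩ := hx
    exact ⟨t, ht, s, hs, by abel⟩

/-- The image of a generating submonoid under a surjection onto `ℤ` which is nonnegative on it
contains all large integers. -/
theorem exists_conductor {G : Type*} [AddCommGroup G] {S : AddSubmonoid G} (φ : G →+ ℤ)
    (hφ : Function.Surjective φ) (hS : ∀ g, ∃ s ∈ S, ∃ t ∈ S, g = s - t)
    (hpos : ∀ s ∈ S, 0 ≤ φ s) : ∃ C : ℤ, ∀ n, C ≤ n → ∃ s ∈ S, φ s = n := by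
  obtain ⟨g, hg⟩ := hφ 1
  obtain ⟨s, hs, t, ht, rfl⟩ := hS g
  rw [map_sub] at hg
  have h0 := hpos t ht
  rcases h0.eq_or_lt with h0 | h0
  · refine ⟨0, fun n hn => ⟨n.toNat • s, S.nsmul_mem hs _, ?_⟩⟩
    rw [map_nsmul, show φ s = 1 by omega, nsmul_eq_mul, mul_one, Int.toNat_of_nonneg hn]
  -- With `T = φ t` and `φ s = T + 1`, write `n = q T + r`, `0 ≤ r < T`. For `n ≥ T * T` one has `q
  -- ≥ T > r`, and `(q - r) t + r s` has value `n`.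
  · refine ⟨φ t * φ t, fun n hn => ?_⟩
    have hr0 := Int.emod_nonneg n h0.ne'
    have hr1 := Int.emod_lt_of_pos n h0
    have hq : φ t ≤ n / φ t := (Int.le_ediv_iff_mul_le h0).2 hn
    refine ⟨(n / φ t - n % φ t).toNat • t + (n % φ t).toNat • s,
      add_mem (S.nsmul_mem ht _) (S.nsmul_mem hs _), ?_⟩
    rw [map_add, map_nsmul, map_nsmul, nsmul_eq_mul, nsmul_eq_mul, Int.toNat_of_nonneg hr0,
      Int.toNat_of_nonneg (by omega), show φ s = φ t + 1 by omega]
    linear_combination Int.emod_add_mul_ediv n (φ t)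

/-! ### Faces of the cone, supporting functionals and primitive support functions -/

section Cones

variable {d : ℕ} {A : Finset (Fin d → ℤ)} {τ : PointedCone ℝ (Fin d → ℝ)}

theorem castVec_mem_cone {a : Fin d → ℤ} (ha : a ∈ A) : castVec ℝ a ∈ cone A :=
  PointedCone.subset_hull ⟨a, ha, rfl⟩

theorem castVec_mem_cone_of_mem_closure {s : Fin d → ℤ}
    (hs : s ∈ AddSubmonoid.closure (A : Set (Fin d → ℤ))) : castVec ℝ s ∈ cone A := by
  have : AddSubmonoid.closure (A : Set (Fin d → ℤ))
      ≤ (cone A).toAddSubmonoid.comap (castVecHom ℝ d) :=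
    (AddSubmonoid.closure_le).2 fun a ha => castVec_mem_cone ha
  exact this hs

/-- If a nonnegative combination of generators lies in a face, so does each generator with positive
coefficient. -/
theorem face_le_hull_restrict (hτ : τ.IsFaceOf (cone A)) :
    τ ≤ PointedCone.hull ℝ (castVec ℝ '' restrict A τ) := by
  intro x hx
  obtain ⟨c, hc, hc0, rfl⟩ := PointedCone.mem_hull_set.1 (hτ.le hx)
  rw [Finsupp.sum, ← Finset.sum_coe_sort] at hx
  have hmem (y : c.support) : (y : Fin d → ℝ) ∈ cone A := PointedCone.subset_hull (hc y.2)
  refine Submodule.sum_mem _ fun y hy => PointedCone.smul_mem _ (hc0 y) ?_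
  have hyτ := hτ.mem_of_sum_smul_mem hmem (fun y => hc0 y) hx ⟨y, hy⟩
    ((hc0 y).lt_of_ne (Finsupp.mem_support_iff.1 hy).symm)
  obtain ⟨a, ha, rfl⟩ := hc hy
  exact PointedCone.subset_hull ⟨a, ⟨ha, hyτ⟩, rfl⟩

theorem face_le_of_restrict_subset (hτ : τ.IsFaceOf (cone A)) {σ : PointedCone ℝ (Fin d → ℝ)}
    (h : ∀ a ∈ restrict A τ, castVec ℝ a ∈ σ) : τ ≤ σ := by
  refine (face_le_hull_restrict hτ).trans (Submodule.span_le.2 ?_)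
  rintro _ ⟨a, ha, rfl⟩
  exact h a ha

theorem span_face_le (hτ : τ.IsFaceOf (cone A)) {V : Submodule ℝ (Fin d → ℝ)}
    (h : ∀ a ∈ restrict A τ, castVec ℝ a ∈ V) :
    Submodule.span ℝ (τ : Set (Fin d → ℝ)) ≤ V := by
  have := face_le_of_restrict_subset hτ (σ := PointedCone.ofSubmodule V) h
  exact Submodule.span_le.2 this

/-- Elements of the span are differences of elements of `τ`; if `x + v` and `v` are in `τ` with `x`
in the cone, the face property puts `x` in `τ`. -/
theorem mem_face_of_mem_span (hτ : τ.IsFaceOf (cone A)) {x : Fin d → ℝ} (hx : x ∈ cone A)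
    (h : x ∈ Submodule.span ℝ (castVec ℝ '' restrict A τ)) : x ∈ τ := by
  suffices ∃ v ∈ τ, x + v ∈ τ by
    obtain ⟨v, hv, hxv⟩ := this
    exact hτ.mem_of_add_mem_left hx (hτ.le hv) hxv
  clear hx
  induction h using Submodule.span_induction with
  | mem x hx => obtain ⟨a, ha, rfl⟩ := hx; exact ⟨0, zero_mem _, by simpa using ha.2⟩
  | zero => exact ⟨0, zero_mem _, by simp⟩
  | add x y _ _ hx hy =>
    obtain ⟨v, hv, hxv⟩ := hx
    obtain ⟨v', hv', hyv⟩ := hy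
    exact ⟨v + v', add_mem hv hv', by convert add_mem hxv hyv using 1; abel⟩
  | smul r x _ hx =>
    obtain ⟨v, hv, hxv⟩ := hx
    rcases le_total 0 r with hr | hr
    · exact ⟨r • v, PointedCone.smul_mem _ hr hv, by
        rw [← smul_add]; exact PointedCone.smul_mem _ hr hxv⟩
    · refine ⟨(-r) • (x + v), PointedCone.smul_mem _ (by linarith) hxv, ?_⟩
      have e : r • x + (-r) • (x + v) = (-r) • v := by module
      rw [e]
      exact PointedCone.smul_mem _ (by linarith) hv

theorem span_cone_eq_top (hA : AddSubgroup.closure (A : Set (Fin d → ℤ)) = ⊤) :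
    Submodule.span ℝ (cone A : Set (Fin d → ℝ)) = ⊤ := by
  rw [eq_top_iff, ← span_castVec_eq_top ℝ hA]
  exact Submodule.span_mono PointedCone.subset_hull

theorem interior_cone_nonempty (hA : AddSubgroup.closure (A : Set (Fin d → ℤ)) = ⊤) :
    (interior (cone A : Set (Fin d → ℝ))).Nonempty := by
  rw [(cone A).convex.interior_nonempty_iff_affineSpan_eq_top,
    AffineSubspace.affineSpan_eq_top_iff_vectorSpan_eq_top_of_nonempty ℝ _ _
      ⟨0, zero_mem (cone A)⟩,
    vectorSpan_eq_span_vsub_set_right ℝ (zero_mem (cone A) : (0 : Fin d → ℝ) ∈ _)]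
  simpa using span_cone_eq_top hA

theorem pos_of_ne_zero (hA : AddSubgroup.closure (A : Set (Fin d → ℤ)) = ⊤)
    {H : (Fin d → ℝ) →ₗ[ℝ] ℝ} (hH : H ≠ 0) (hpos : ∀ x ∈ cone A, 0 ≤ H x) :
    0 < H (castVec ℝ (∑ a ∈ A, a)) := by
  have e : H (castVec ℝ (∑ a ∈ A, a)) = ∑ a ∈ A, H (castVec ℝ a) := by
    rw [← castVecHom_apply, map_sum, map_sum]; rfl
  have hnn : ∀ a ∈ A, 0 ≤ H (castVec ℝ a) := fun a ha => hpos _ (castVec_mem_cone ha)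
  rw [e]
  refine (Finset.sum_nonneg hnn).lt_of_ne' fun h => hH ?_
  rw [Finset.sum_eq_zero_iff_of_nonneg hnn] at h
  have hle : Submodule.span ℝ (castVec ℝ '' (A : Set (Fin d → ℤ))) ≤ LinearMap.ker H := by
    refine Submodule.span_le.2 ?_
    rintro _ ⟨a, ha, rfl⟩
    exact h a ha
  rw [span_castVec_eq_top ℝ hA, top_le_iff] at hle
  exact LinearMap.ker_eq_top.1 hle

/-- A proper face of the cone has a supporting hyperplane. -/
theorem exists_support (hA : AddSubgroup.closure (A : Set (Fin d → ℤ)) = ⊤)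
    (hτ : τ.IsFaceOf (cone A)) (hne : τ ≠ cone A) :
    ∃ H : (Fin d → ℝ) →ₗ[ℝ] ℝ, H ≠ 0 ∧ (∀ x ∈ cone A, 0 ≤ H x) ∧ ∀ x ∈ τ, H x = 0 := by
  classical
  set B := A.filter fun a => castVec ℝ a ∈ τ with hB
  set e := ∑ a ∈ B, castVec ℝ a with he
  have heτ : e ∈ τ := Submodule.sum_mem _ fun a ha => (Finset.mem_filter.1 ha).2
  -- If `e` were interior, `e - t • w` would stay in the cone for small `t > 0`, so `w` and with it
  -- every generator would lie in the face.
  have hint : e ∉ interior (cone A : Set (Fin d → ℝ)) := by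
    intro h
    set w := ∑ a : A, castVec ℝ (a : Fin d → ℤ) with hw
    have hwc : w ∈ cone A := Submodule.sum_mem _ fun a _ => castVec_mem_cone a.2
    have hcont : Filter.Tendsto (fun t : ℝ => e - t • w) (nhdsWithin 0 (Set.Ioi 0)) (nhds e) := by
      have : Continuous fun t : ℝ => e - t • w := by fun_prop
      simpa using (this.tendsto 0).mono_left nhdsWithin_le_nhds
    obtain ⟨t, ht, ht0⟩ := ((hcont.eventually (mem_interior_iff_mem_nhds.1 h)).and
      self_mem_nhdsWithin).exists
    have hwτ : w ∈ τ := hτ.mem_of_smul_add_mem hwc ht ht0 (by simpa using heτ)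
    refine hne (le_antisymm hτ.le (Submodule.span_le.2 ?_))
    rintro _ ⟨a, ha, rfl⟩
    exact hτ.mem_of_sum_mem (fun a : A => castVec_mem_cone a.2) hwτ ⟨a, ha⟩
  obtain ⟨f, hf0, hf⟩ := geometric_hahn_banach_of_nonempty_interior_point (cone A).convex hint
    (interior_cone_nonempty hA)
  have h1 := hf 0 (zero_mem (cone A))
  -- The bound `f ≤ f e`, evaluated at `0` and at `2 e`, forces `f e = 0`.
  have h2 := hf (e + e) (add_mem (hτ.le heτ) (hτ.le heτ))
  rw [map_zero] at h1
  rw [map_add] at h2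
  have hfe : f e = 0 := by linarith
  have hle : ∀ x ∈ cone A, f x ≤ 0 := fun x hx => hfe ▸ hf x hx
  have hker : Submodule.span ℝ (τ : Set (Fin d → ℝ)) ≤ LinearMap.ker (f : (Fin d → ℝ) →ₗ[ℝ] ℝ) := by
    refine span_face_le hτ fun a ha => ?_
    rw [he, map_sum, Finset.sum_eq_zero_iff_of_nonpos] at hfe
    · exact hfe a (Finset.mem_filter.2 ha)
    · exact fun a ha => hle _ (castVec_mem_cone (Finset.mem_filter.1 ha).1)
  refine ⟨-(f : (Fin d → ℝ) →ₗ[ℝ] ℝ), fun h => hf0 ?_, fun x hx => by simpa using hle x hx,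
    fun x hx => by simpa using hker (Submodule.subset_span hx)⟩
  ext x
  simpa using LinearMap.congr_fun h x

/-- A face of codimension at least two has a supporting hyperplane which contains a further
generator of the cone. -/
theorem exists_support_of_one_lt_codim (hA : AddSubgroup.closure (A : Set (Fin d → ℤ)) = ⊤)
    (hτ : τ.IsFaceOf (cone A)) (hcodim : 1 < codim τ) :
    ∃ c ∈ A, castVec ℝ c ∉ τ ∧ ∃ H : (Fin d → ℝ) →ₗ[ℝ] ℝ, H ≠ 0 ∧ (∀ x ∈ cone A, 0 ≤ H x) ∧
      (∀ x ∈ τ, H x = 0) ∧ H (castVec ℝ c) = 0 := by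
  classical
  have hne : τ ≠ cone A := by
    rintro rfl
    rw [codim, span_cone_eq_top hA] at hcodim
    simp at hcodim
  obtain ⟨H, hH0, hpos, hHτ⟩ := exists_support hA hτ hne
  -- Codimension at least two leaves room for a functional that vanishes on `τ` and is independent
  -- of `H`.
  obtain ⟨L, hL, hLH⟩ : ∃ L ∈ (Submodule.span ℝ (τ : Set (Fin d → ℝ))).dualAnnihilator,
      L ∉ Submodule.span ℝ {H} := by
    by_contra! h
    have h1 := Submodule.finrank_mono (show (Submodule.span ℝ (τ : Set (Fin d → ℝ))).dualAnnihilator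
      ≤ Submodule.span ℝ {H} from h)
    rw [finrank_span_singleton hH0] at h1
    have h3 := Subspace.finrank_add_finrank_dualAnnihilator_eq
      (Submodule.span ℝ (τ : Set (Fin d → ℝ)))
    rw [Module.finrank_fin_fun] at h3
    rw [codim] at hcodim
    omega
  have hLτ : ∀ x ∈ τ, L x = 0 := fun x hx =>
    (Submodule.mem_dualAnnihilator L).1 hL x (Submodule.subset_span hx)
  have hout : (A.filter fun a => castVec ℝ a ∉ τ).Nonempty := by
    by_contra h
    rw [Finset.not_nonempty_iff_eq_empty, Finset.filter_eq_empty_iff] at h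
    refine hne (le_antisymm hτ.le (Submodule.span_le.2 ?_))
    rintro _ ⟨a, ha, rfl⟩
    exact not_not.1 (h ha)
  by_cases hc : ∃ c ∈ A, castVec ℝ c ∉ τ ∧ H (castVec ℝ c) = 0
  · obtain ⟨c, hcA, hcτ, hc⟩ := hc
    exact ⟨c, hcA, hcτ, H, hH0, hpos, hHτ, hc⟩
  push Not at hc
  -- Now `H` is positive on all generators outside `τ`. Tilt it by `L` until it first touches one of
  -- them: the maximal ratio `L / H` keeps the tilted functional nonnegative and makes it vanish at
  -- the maximizer.
  obtain ⟨c, hcm, hmax⟩ := Finset.exists_max_image _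
    (fun a => L (castVec ℝ a) / H (castVec ℝ a)) hout
  obtain ⟨hcA, hcτ⟩ := Finset.mem_filter.1 hcm
  refine ⟨c, hcA, hcτ, (L (castVec ℝ c) / H (castVec ℝ c)) • H - L, fun h => hLH ?_, ?_, ?_, ?_⟩
  · exact Submodule.mem_span_singleton.2 ⟨_, sub_eq_zero.1 h⟩
  · suffices cone A ≤ (PointedCone.positive ℝ ℝ).comap
        ((L (castVec ℝ c) / H (castVec ℝ c)) • H - L) from fun x hx => this hx
    refine Submodule.span_le.2 ?_
    rintro _ ⟨a, ha, rfl⟩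
    change 0 ≤ L (castVec ℝ c) / H (castVec ℝ c) * H (castVec ℝ a) - L (castVec ℝ a)
    by_cases haτ : castVec ℝ a ∈ τ
    · simp [hHτ _ haτ, hLτ _ haτ]
    · have hHa : 0 < H (castVec ℝ a) :=
        (hpos _ (castVec_mem_cone ha)).lt_of_ne (hc a ha haτ).symm
      have := hmax a (Finset.mem_filter.2 ⟨ha, haτ⟩)
      rw [div_le_iff₀ hHa] at this
      linarith
  · intro x hx
    simp [hHτ x hx, hLτ x hx]
  · simp [div_mul_cancel₀ _ (hc c hcA hcτ)]

/-- A primitive integral support function restricts to a surjection `ℤ^d → ℤ`. -/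
theorem IsPrimitiveSupport.exists_hom {F : (Fin d → ℝ) →ₗ[ℝ] ℝ}
    (hF : IsPrimitiveSupport A τ F) : ∃ φ : (Fin d → ℤ) →+ ℤ,
      Function.Surjective φ ∧ ∀ z, F (castVec ℝ z) = φ z := by
  have h (z : Fin d → ℤ) : ∃ n : ℤ, (n : ℝ) = F (castVec ℝ z) := by
    have : F (castVec ℝ z) ∈ Set.range fun n : ℤ => (n : ℝ) := hF.image ▸ ⟨z, rfl⟩
    exact this
  choose φ hφ using h
  refine ⟨AddMonoidHom.mk' φ fun x y => ?_, fun n => ?_, fun z => (hφ z).symm⟩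
  · have := map_add (F.toAddMonoidHom.comp (castVecHom ℝ d)) x y
    have h' : F (castVec ℝ (x + y)) = F (castVec ℝ x) + F (castVec ℝ y) := this
    rw [← hφ, ← hφ, ← hφ] at h'
    exact_mod_cast h'
  · have : (n : ℝ) ∈ Set.range fun z : Fin d → ℤ => F (castVec ℝ z) := hF.image ▸ ⟨n, rfl⟩
    obtain ⟨z, hz⟩ := this
    exact ⟨z, by exact_mod_cast (hφ z).trans hz⟩

/-- The generators on which `F` vanishes span its kernel, so two such forms vanishing on the same
subset of `A` are proportional. Primitivity makes the factor `±1`, and positivity on the sum of the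
generators fixes the sign. -/
theorem finite_primitiveSupport (hA : AddSubgroup.closure (A : Set (Fin d → ℤ)) = ⊤) :
    {F : (Fin d → ℝ) →ₗ[ℝ] ℝ | ∃ σ, IsFacet A σ ∧ IsPrimitiveSupport A σ F}.Finite := by
  classical
  refine Set.Finite.of_injOn (f := fun F => A.filter fun a => F (castVec ℝ a) = 0)
    (t := (A.powerset : Set (Finset (Fin d → ℤ))))
    (fun F _ => Finset.mem_powerset.2 (Finset.filter_subset _ _)) ?_ (Finset.finite_toSet _)
  rintro F ⟨σ, hσ, hF⟩ F' ⟨σ', -, hF'⟩ (heq : A.filter _ = A.filter _)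
  obtain ⟨φ, hφs, hφ⟩ := hF.exists_hom
  obtain ⟨φ', hφs', hφ'⟩ := hF'.exists_hom
  obtain ⟨z, hz⟩ := hφs 1
  obtain ⟨z', hz'⟩ := hφs' 1
  have hFz : F (castVec ℝ z) = 1 := by rw [hφ, hz, Int.cast_one]
  have hFz' : F' (castVec ℝ z') = 1 := by rw [hφ', hz', Int.cast_one]
  have hF0 : F ≠ 0 := by rintro rfl; simp at hFz
  have hF0' : F' ≠ 0 := by rintro rfl; simp at hFz'
  have hle : Submodule.span ℝ (σ : Set (Fin d → ℝ)) ≤ LinearMap.ker F :=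
    Submodule.span_le.2 hF.zero
  have hker : Submodule.span ℝ (σ : Set (Fin d → ℝ)) = LinearMap.ker F := by
    refine Submodule.eq_of_le_of_finrank_le hle ?_
    have h1 := hσ.2
    have h2 := F.finrank_range_add_finrank_ker
    rw [LinearMap.range_eq_top.2 (LinearMap.surjective hF0), finrank_top, Module.finrank_self,
      Module.finrank_fin_fun] at h2
    rw [codim] at h1
    omega
  have hker' : LinearMap.ker F ≤ LinearMap.ker F' := by
    rw [← hker]
    refine span_face_le hσ.1 fun a ha => ?_
    have : a ∈ A.filter fun a => F (castVec ℝ a) = 0 :=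
      Finset.mem_filter.2 ⟨ha.1, hF.zero _ ha.2⟩
    rw [heq] at this
    exact (Finset.mem_filter.1 this).2
  have hspan : F' ∈ Submodule.span ℝ (Set.range fun _ : Unit => F) :=
    mem_span_of_iInf_ker_le_ker (by simpa using hker')
  rw [Set.range_const, Submodule.mem_span_singleton] at hspan
  obtain ⟨r, rfl⟩ := hspan
  have hr : r = φ' z := by rw [← hφ' z]; simp [hFz]
  have h1 : φ' z * φ z' = 1 := by
    rw [LinearMap.smul_apply, hφ, hr, smul_eq_mul] at hFz'
    exact_mod_cast hFz'
  have hr0 : 0 ≤ r := by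
    have hw := pos_of_ne_zero hA hF0 hF.nonneg
    have hw' := pos_of_ne_zero hA hF0' hF'.nonneg
    rw [LinearMap.smul_apply, smul_eq_mul] at hw'
    exact (pos_of_mul_pos_left hw' hw.le).le
  have hr0' : 0 ≤ φ' z := by rw [hr] at hr0; exact_mod_cast hr0
  have h2 : φ' z = 1 := by
    rcases Int.eq_one_or_neg_one_of_mul_eq_one h1 with h | h <;> omega
  rw [hr, h2, Int.cast_one, one_smul]

end Cones

/-! ### Separating a point from a set by a polynomial function -/

section Separation

variable {K G : Type*} [Field K] [AddCommGroup G]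

/-- `x` is separated from `T` by a polynomial function, i.e. `x` does not lie in the Zariski
closure of `T`. -/
def IsPolySeparated (K : Type*) [Field K] (x : G) (T : Set G) : Prop :=
  ∃ q : G → K, (∃ n, IsPolyFun n q) ∧ q x ≠ 0 ∧ ∀ s ∈ T, q s = 0

theorem IsPolySeparated.mono {x : G} {T T' : Set G} (h : IsPolySeparated K x T) (hT : T' ⊆ T) :
    IsPolySeparated K x T' := by
  obtain ⟨q, hq, hx, hv⟩ := h
  exact ⟨q, hq, hx, fun s hs => hv s (hT hs)⟩

theorem IsPolySeparated.biUnion {ι : Type*} {x : G} (I : Finset ι) {T : ι → Set G}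
    (h : ∀ i ∈ I, IsPolySeparated K x (T i)) : IsPolySeparated K x (⋃ i ∈ I, T i) := by
  classical
  choose! q hq hx hv using h
  refine ⟨∏ i ∈ I, q i, IsPolyFun.exists_prod I q hq, ?_, fun s hs => ?_⟩
  · rw [Finset.prod_apply]
    exact Finset.prod_ne_zero_iff.2 hx
  · obtain ⟨i, hi, hs⟩ := Set.mem_iUnion₂.1 hs
    rw [Finset.prod_apply]
    exact Finset.prod_eq_zero hi (hv i hi s hs)

theorem IsPolySeparated.union {x : G} {T T' : Set G} (h : IsPolySeparated K x T)
    (h' : IsPolySeparated K x T') : IsPolySeparated K x (T ∪ T') := by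
  obtain ⟨q, ⟨m, hq⟩, hx, hv⟩ := h
  obtain ⟨q', ⟨n, hq'⟩, hx', hv'⟩ := h'
  refine ⟨q * q', ⟨m + n, hq.mul hq'⟩, mul_ne_zero hx hx', ?_⟩
  rintro s (hs | hs)
  · simp [hv s hs]
  · simp [hv' s hs]

theorem isPolySeparated_fiber {x : G} (f : G →+ K) {c : K} (hx : f x ≠ c) :
    IsPolySeparated K x {s | f s = c} :=
  ⟨fun s => f s + -c, ⟨2, IsPolyFun.affine f (-c)⟩,
    fun h => hx (eq_of_sub_eq_zero ((sub_eq_add_neg _ _).trans h)),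
    fun _ hs => (sub_eq_add_neg _ _).symm.trans (sub_eq_zero.2 hs)⟩

theorem isPolySeparated_empty (x : G) : IsPolySeparated K x ∅ :=
  ⟨fun _ => 1, ⟨1, IsPolyFun.const 1⟩, one_ne_zero, fun _ h => h.elim⟩

/-- By the conductor bound, the bad `s` have only finitely many values `φ s`. The value `φ x` is not
among them, since it would give `φ (s + (b - x)) = φ b`, which is attained on `S`. So finitely many
hyperplanes missing `x` cover the set. -/
theorem isPolySeparated_gap [CharZero K] {S : AddSubmonoid G} (φ : G →+ ℤ)
    (hφ : Function.Surjective φ) (hS : ∀ g, ∃ s ∈ S, ∃ t ∈ S, g = s - t)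
    (hpos : ∀ s ∈ S, 0 ≤ φ s) {b x : G} (hb : ∃ s ∈ S, φ s = φ b) :
    IsPolySeparated K x {s | s ∈ S ∧ ¬ ∃ s' ∈ S, φ s' = φ (s + (b - x))} := by
  obtain ⟨C, hC⟩ := exists_conductor φ hφ hS hpos
  refine IsPolySeparated.mono (IsPolySeparated.biUnion
    ((Finset.Icc 0 (C - φ b + φ x)).erase (φ x)) (T := fun t => {s | φ s = t}) fun t ht => ?_) ?_
  · refine (isPolySeparated_fiber (K := K) (c := (t : K))
      ((Int.castAddHom K).comp φ) ?_).mono fun s hs => ?_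
    · simpa using (Finset.ne_of_mem_erase ht).symm
    · simp [show φ s = t from hs]
  · rintro s ⟨hs, hns⟩
    refine Set.mem_iUnion₂.2 ⟨φ s, ?_, rfl⟩
    rw [map_add, map_sub] at hns
    refine Finset.mem_erase.2 ⟨fun h => hns ?_, Finset.mem_Icc.2 ⟨hpos s hs, ?_⟩⟩
    · rwa [h, add_sub_cancel]
    · by_contra hlt
      exact hns (hC _ (by omega))

end Separation

/-! ### Saturated lattices of faces, and rays leaving their cosets -/

section FaceLattice

variable {d : ℕ}

/-- The integer vectors whose image in `K^d` lies in `Kτ`. -/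
noncomputable def faceLattice (K : Type*) [Field K] (A : Finset (Fin d → ℤ))
    (τ : PointedCone ℝ (Fin d → ℝ)) : AddSubgroup (Fin d → ℤ) :=
  (faceSpan K A τ).toAddSubgroup.comap (castVecHom K d)

variable {K : Type*} [Field K] {A : Finset (Fin d → ℤ)} {τ σ : PointedCone ℝ (Fin d → ℝ)}

theorem mem_faceLattice {z : Fin d → ℤ} :
    z ∈ faceLattice K A τ ↔ castVec K z ∈ faceSpan K A τ := Iff.rfl

theorem closure_restrict_le_faceLattice :
    AddSubgroup.closure (restrict A τ) ≤ faceLattice K A τ :=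
  fun _ hz => castVec_mem_span_of_mem_closure K hz

theorem restrict_mono (h : τ ≤ σ) : restrict A τ ⊆ restrict A σ := fun _ ha => ⟨ha.1, h ha.2⟩

variable [CharZero K]

theorem faceLattice_saturated {n : ℕ} (hn : n ≠ 0) {z : Fin d → ℤ}
    (h : n • z ∈ faceLattice K A τ) : z ∈ faceLattice K A τ := by
  have h' : (n : K) • castVec K z ∈ faceSpan K A τ := by
    have : castVecHom K d (n • z) ∈ faceSpan K A τ := h
    rwa [map_nsmul, ← Nat.cast_smul_eq_nsmul K] at this
  exact ((faceSpan K A τ).smul_mem_iff (Nat.cast_ne_zero.2 hn)).1 h'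

theorem castVec_mem_span_of_mem_faceLattice {z : Fin d → ℤ} (h : z ∈ faceLattice K A τ) :
    castVec ℝ z ∈ Submodule.span ℝ (castVec ℝ '' restrict A τ) :=
  castVec_mem_span_of_charZero K ℝ h

theorem mem_face_of_mem_faceLattice (hτ : τ.IsFaceOf (cone A)) {s : Fin d → ℤ}
    (hs : s ∈ AddSubmonoid.closure (A : Set (Fin d → ℤ))) (h : s ∈ faceLattice K A τ) :
    castVec ℝ s ∈ τ :=
  mem_face_of_mem_span hτ (castVec_mem_cone_of_mem_closure hs)
    (castVec_mem_span_of_mem_faceLattice h)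

/-- The sum of the generators in a face lies in another face only if the faces are nested. -/
theorem exists_interior_vector (hτ : τ.IsFaceOf (cone A)) :
    ∃ e ∈ AddSubmonoid.closure (A : Set (Fin d → ℤ)), e ∈ AddSubgroup.closure (restrict A τ) ∧
      ∀ σ, σ.IsFaceOf (cone A) → e ∈ faceLattice K A σ → τ ≤ σ := by
  classical
  have hB {a : Fin d → ℤ} : a ∈ (A.filter fun a => castVec ℝ a ∈ τ) ↔ a ∈ restrict A τ :=
    Finset.mem_filter
  have hmem : ∑ a ∈ A.filter fun a => castVec ℝ a ∈ τ, a
      ∈ AddSubmonoid.closure (A : Set (Fin d → ℤ)) :=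
    sum_mem fun a ha => AddSubmonoid.subset_closure (hB.1 ha).1
  refine ⟨_, hmem, sum_mem fun a ha => AddSubgroup.subset_closure (hB.1 ha), fun σ hσ h => ?_⟩
  have hσe := mem_face_of_mem_faceLattice hσ hmem h
  rw [← castVecHom_apply, map_sum, ← Finset.sum_coe_sort] at hσe
  refine face_le_of_restrict_subset hτ fun a ha => ?_
  exact hσ.mem_of_sum_mem (fun a : A.filter fun a => castVec ℝ a ∈ τ =>
    castVec_mem_cone (hB.1 a.2).1) hσe ⟨a, hB.2 ha⟩

end FaceLattice

/-- A ray avoids finitely many cosets of saturated subgroups from some point on. -/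
theorem exists_forall_ge_notMem {G ι : Type*} [AddCommGroup G] [Finite ι] (W : ι → AddSubgroup G)
    (u : ι → G) {v : G} (I : Set ι) (hsat : ∀ i ∈ I, ∀ n : ℕ, n ≠ 0 → n • v ∉ W i) :
    ∃ M : ℕ, ∀ N, M ≤ N → ∀ i ∈ I, u i + N • v ∉ W i := by
  -- Two hits `p < q` would put `(q - p) • v` in `W i`, so each coset is met at most once.
  have hsub (i : I) : {N : ℕ | u i + N • v ∈ W i}.Subsingleton := by
    have key (p q : ℕ) (h : p < q) (hp : u i + p • v ∈ W i) (hq : u i + q • v ∈ W i) : False := by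
      refine hsat i i.2 (q - p) (by omega) ?_
      have := (W i).sub_mem hq hp
      rwa [add_sub_add_left_eq_sub, sub_eq_add_neg, ← sub_nsmul _ h.le] at this
    intro p hp q hq
    rcases lt_trichotomy p q with h | h | h
    · exact (key p q h hp hq).elim
    · exact h
    · exact (key q p h hq hp).elim
  obtain ⟨M, hM⟩ := (Set.finite_iUnion fun i : I => (hsub i).finite).bddAbove
  refine ⟨M + 1, fun N hN i hi h => ?_⟩
  have := hM (Set.mem_iUnion.2 ⟨⟨i, hi⟩, h⟩)
  omega

/-! ### Holes of `S`, and construction of the data for the criterion -/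

section StandardExpressions

variable {d m : ℕ} {A : Finset (Fin d → ℤ)} {b : Fin m → (Fin d → ℤ)}
  {τ : Fin m → PointedCone ℝ (Fin d → ℝ)}

theorem add_mem_scoredClosure {S : AddSubmonoid (Fin d → ℤ)} {a s : Fin d → ℤ}
    (ha : a ∈ scoredClosure A S) (hs : s ∈ S) : a + s ∈ scoredClosure A S := by
  intro σ hσ F hF
  obtain ⟨t, ht, h⟩ := ha σ hσ F hF
  refine ⟨t + s, S.add_mem ht hs, ?_⟩
  simp only [← castVecHom_apply, map_add] at h ⊢
  rw [h]

theorem IsStandardExpression.mem_of_forall_notMem {S : Set (Fin d → ℤ)}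
    (hS : IsStandardExpression A S b τ) {z : Fin d → ℤ} (hz : z ∈ scoredClosure A S)
    (h : ∀ i, z - b i ∉ AddSubgroup.closure (restrict A (τ i))) : z ∈ S := by
  rw [hS.eq_diff]
  exact ⟨hz, fun hz' => by
    obtain ⟨i, hi⟩ := Set.mem_iUnion.1 hz'
    exact h i hi⟩

theorem IsStandardExpression.notMem_of_mem {S : Set (Fin d → ℤ)}
    (hS : IsStandardExpression A S b τ) {z : Fin d → ℤ} {i : Fin m}
    (h : z - b i ∈ AddSubgroup.closure (restrict A (τ i))) : z ∉ S := by
  rw [hS.eq_diff]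
  exact fun hz => hz.2 (Set.mem_iUnion.2 ⟨i, h⟩)

/-- Otherwise the removed coset would be all of `ℤ^d`, although `0 ∈ S`. -/
theorem IsStandardExpression.face_ne_cone (hA : AddSubgroup.closure (A : Set (Fin d → ℤ)) = ⊤)
    (hS : IsStandardExpression A
      (AddSubmonoid.closure (A : Set (Fin d → ℤ)) : Set (Fin d → ℤ)) b τ) (i : Fin m) :
    τ i ≠ cone A := by
  intro h
  have hr : restrict A (τ i) = A := by
    ext a
    exact ⟨fun ha => ha.1, fun ha => ⟨ha, h ▸ castVec_mem_cone ha⟩⟩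
  refine hS.notMem_of_mem (z := 0) (i := i) ?_ (zero_mem _)
  rw [hr, hA]
  exact AddSubgroup.mem_top _

/-- Otherwise the coset of `b j` would be contained in that of `b i` and could be omitted. -/
theorem IsStandardExpression.notMem_of_ne {S : Set (Fin d → ℤ)}
    (hS : IsStandardExpression A S b τ) {i j : Fin m} (hij : i ≠ j) (hle : τ j ≤ τ i) :
    b j - b i ∉ AddSubgroup.closure (restrict A (τ i)) := by
  intro h
  refine hS.irredundant j (hS.eq_diff.trans ?_)
  congr 1
  refine Set.Subset.antisymm (Set.iUnion_subset fun k z hz => ?_)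
    (Set.iUnion_mono fun k => Set.iUnion_subset fun _ => Set.Subset.rfl)
  by_cases hk : k = j
  · subst hk
    refine Set.mem_iUnion₂.2 ⟨i, hij, ?_⟩
    have hz' : z - b k ∈ AddSubgroup.closure (restrict A (τ i)) :=
      AddSubgroup.closure_mono (restrict_mono hle) hz
    have := add_mem hz' h
    rwa [sub_add_sub_cancel] at this
  · exact Set.mem_iUnion₂.2 ⟨k, hk, hz⟩

/-- The degree-`b - x` component of `D(K[S])` contains an operator not vanishing at `x`. -/
theorem isPolySeparated_of_support {K : Type*} [Field K] [CharZero K]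
    (hA : AddSubgroup.closure (A : Set (Fin d → ℤ)) = ⊤)
    (hS : IsStandardExpression A
      (AddSubmonoid.closure (A : Set (Fin d → ℤ)) : Set (Fin d → ℤ)) b τ)
    {c x : Fin d → ℤ}
    (hc : c ∈ scoredClosure A (AddSubmonoid.closure (A : Set (Fin d → ℤ)) : Set (Fin d → ℤ)))
    (hx : ∀ i, c - b i ∈ faceLattice K A (τ i) → ∃ H : (Fin d → ℝ) →ₗ[ℝ] ℝ,
      (∀ y ∈ cone A, 0 ≤ H y) ∧ (∀ y ∈ τ i, H y = 0) ∧ H (castVec ℝ x) < 0) :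
    IsPolySeparated K x {s | s ∈ AddSubmonoid.closure (A : Set (Fin d → ℤ)) ∧
      s + (c - x) ∉ AddSubmonoid.closure (A : Set (Fin d → ℤ))} := by
  classical
  set S := AddSubmonoid.closure (A : Set (Fin d → ℤ)) with hSdef
  -- A point leaves `S` either by leaving the scored closure, detected by finitely many `F`, or by
  -- falling into one of the removed cosets; these are separated from `x` one at a time.
  have hfacet : ∀ F ∈ (finite_primitiveSupport hA).toFinset, IsPolySeparated K x
      {s | s ∈ S ∧ F (castVec ℝ (s + (c - x))) ∉ (fun s => F (castVec ℝ s)) '' (S : Set _)} := by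
    intro F hF
    obtain ⟨σ, hσ, hF⟩ := (finite_primitiveSupport hA).mem_toFinset.1 hF
    obtain ⟨φ, hφs, hφ⟩ := hF.exists_hom
    refine (isPolySeparated_gap φ hφs (exists_sub_of_closure_eq_top hA) (fun s hs => ?_)
      (b := c) ?_).mono ?_
    · have := hF.nonneg _ (castVec_mem_cone_of_mem_closure hs)
      rw [hφ] at this
      exact_mod_cast this
    · obtain ⟨s, hs, h⟩ := hc σ hσ F hF
      simp only [hφ, Int.cast_inj] at h
      exact ⟨s, hs, h⟩
    · rintro s ⟨hs, hns⟩
      refine ⟨hs, fun ⟨s', hs', h⟩ => hns ⟨s', hs', ?_⟩⟩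
      simp only [hφ, h]
  have hcoset : ∀ i ∈ Finset.univ, IsPolySeparated K x
      {s | s ∈ S ∧ s + (c - x) - b i ∈ AddSubgroup.closure (restrict A (τ i))} := by
    intro i _
    by_cases hi : c - b i ∈ faceLattice K A (τ i)
    -- Here `s - x` lies in `K τ i`, so `H s = H x < 0`, impossible for `s ∈ S`: the set is empty.
    · obtain ⟨H, hpos, hzero, hneg⟩ := hx i hi
      refine (isPolySeparated_empty x).mono ?_
      rintro s ⟨hs, h⟩
      have h1 : s - x ∈ faceLattice K A (τ i) := by
        have := sub_mem (closure_restrict_le_faceLattice (K := K) h) hi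
        convert this using 1; abel
      have hker : Submodule.span ℝ (castVec ℝ '' restrict A (τ i)) ≤ LinearMap.ker H := by
        refine Submodule.span_le.2 ?_
        rintro _ ⟨a, ha, rfl⟩
        exact hzero _ ha.2
      have h2 := LinearMap.mem_ker.1 (hker (castVec_mem_span_of_mem_faceLattice h1))
      rw [← castVecHom_apply, map_sub, map_sub, castVecHom_apply, castVecHom_apply] at h2
      have h3 := hpos _ (castVec_mem_cone_of_mem_closure hs)
      exact absurd hneg (by linarith)
    -- A functional killing `K τ i` but not `c - b i` is constant on the set, with a value different
    -- from its value at `x`.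
    · obtain ⟨ℓ, hℓ, hker⟩ := Submodule.exists_le_ker_of_notMem (mem_faceLattice.not.1 hi)
      let f : (Fin d → ℤ) →+ K := ℓ.toAddMonoidHom.comp (castVecHom K d)
      have hf (z : Fin d → ℤ) : f z = ℓ (castVec K z) := rfl
      refine (isPolySeparated_fiber f (c := f (b i - c + x)) ?_).mono ?_
      · rw [map_add, ← neg_sub c (b i), map_neg, hf (c - b i)]
        simpa using hℓ
      · rintro s ⟨-, h⟩
        have h0 : f (s + (c - x) - b i) = 0 := hker (closure_restrict_le_faceLattice (K := K) h)
        rw [show s + (c - x) - b i = s - (b i - c + x) by abel, map_sub, sub_eq_zero] at h0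
        exact h0
  refine ((IsPolySeparated.biUnion _ hfacet).union (IsPolySeparated.biUnion _ hcoset)).mono ?_
  rintro s ⟨hs, hns⟩
  by_contra h
  rw [Set.mem_union, not_or] at h
  simp only [Set.mem_iUnion, not_exists] at h
  refine hns (hS.mem_of_forall_notMem (fun σ hσ F hF => ?_) fun i hi =>
    h.2 i (Finset.mem_univ i) ⟨hs, hi⟩)
  by_contra hF'
  exact h.1 F ((finite_primitiveSupport hA).mem_toFinset.2 ⟨σ, hσ, hF⟩) ⟨hs, hF'⟩

/-- A generator outside of `τ j` that lies on all `τ i ≻ τ j` with `b i - b j ∈ K τ i` and on a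
supporting hyperplane of `τ j`. -/
theorem exists_generator {K : Type*} [Field K]
    (hA : AddSubgroup.closure (A : Set (Fin d → ℤ)) = ⊤)
    (hS : IsStandardExpression A
      (AddSubmonoid.closure (A : Set (Fin d → ℤ)) : Set (Fin d → ℤ)) b τ)
    (j : Fin m) (hcodim : 1 < codim (τ j))
    (hinter : (⨅ (i : Fin m) (_ : τ j < τ i)
      (_ : castVec K (b i - b j) ∈ faceSpan K A (τ i)), τ i) ≠ τ j) :
    ∃ c ∈ A, castVec ℝ c ∉ τ j ∧
      (∀ i, τ j < τ i → castVec K (b i - b j) ∈ faceSpan K A (τ i) → castVec ℝ c ∈ τ i) ∧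
      ∃ H : (Fin d → ℝ) →ₗ[ℝ] ℝ, H ≠ 0 ∧ (∀ y ∈ cone A, 0 ≤ H y) ∧ (∀ y ∈ τ j, H y = 0) ∧
        H (castVec ℝ c) = 0 := by
  by_cases hrel : ∃ i, τ j < τ i ∧ castVec K (b i - b j) ∈ faceSpan K A (τ i)
  · obtain ⟨i₀, hlt, hi₀⟩ := hrel
    set γ := ⨅ (i : Fin m) (_ : τ j < τ i) (_ : castVec K (b i - b j) ∈ faceSpan K A (τ i)), τ i
      with hγ
    have hmem (x : Fin d → ℝ) : x ∈ γ ↔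
        ∀ i, τ j < τ i → castVec K (b i - b j) ∈ faceSpan K A (τ i) → x ∈ τ i := by
      simp only [hγ, Submodule.mem_iInf]
    have hγi₀ : γ ≤ τ i₀ := fun x hx => (hmem x).1 hx i₀ hlt hi₀
    have hface : γ.IsFaceOf (cone A) :=
      ⟨hγi₀.trans (hS.isFace i₀).le, fun hx hy ha hxy => (hmem _).2 fun i h1 h2 =>
        (hS.isFace i).mem_of_smul_add_mem hx hy ha ((hmem _).1 hxy i h1 h2)⟩
    have hjγ : τ j ≤ γ := fun x hx => (hmem x).2 fun i h1 _ => h1.le hx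
    obtain ⟨c, hc, hcj⟩ : ∃ c ∈ restrict A γ, castVec ℝ c ∉ τ j := by
      by_contra! h
      exact hinter (le_antisymm (face_le_of_restrict_subset hface h) hjγ)
    -- Any supporting hyperplane of `τ i₀` contains both `τ j` and `c`.
    obtain ⟨H, hH0, hpos, hzero⟩ := exists_support hA (hS.isFace i₀) (hS.face_ne_cone hA i₀)
    exact ⟨c, hc.1, hcj, (hmem _).1 hc.2, H, hH0, hpos, fun y hy => hzero y (hlt.le hy),
      hzero _ (hγi₀ hc.2)⟩
  · obtain ⟨c, hcA, hcj, H⟩ := exists_support_of_one_lt_codim hA (hS.isFace j) hcodim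
    exact ⟨c, hcA, hcj, fun i h1 h2 => (hrel ⟨i, h1, h2⟩).elim, H⟩

/-- A hole in the coset `b j + ℤ(A ∩ τ j)` which lies in `b i + K τ i` only if `τ j ≤ τ i`. -/
theorem exists_generic_hole {K : Type*} [Field K] [CharZero K]
    (hS : IsStandardExpression A
      (AddSubmonoid.closure (A : Set (Fin d → ℤ)) : Set (Fin d → ℤ)) b τ) (j : Fin m) :
    ∃ h ∈ scoredClosure A (AddSubmonoid.closure (A : Set (Fin d → ℤ)) : Set (Fin d → ℤ)),
      h - b j ∈ AddSubgroup.closure (restrict A (τ j)) ∧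
      ∀ i, h - b i ∈ faceLattice K A (τ i) → τ j ≤ τ i := by
  obtain ⟨e, heS, he, hface⟩ := exists_interior_vector (K := K) (hS.isFace j)
  -- Moving from `b j` along an interior vector `e` of `τ j` leaves `b i + K τ i` eventually unless
  -- `τ j ≤ τ i`.
  obtain ⟨M, hM⟩ := exists_forall_ge_notMem (fun i => faceLattice K A (τ i))
    (fun i => b j - b i) (v := e) {i | ¬ τ j ≤ τ i} fun i hi n hn h =>
      hi (hface _ (hS.isFace i) (faceLattice_saturated hn h))
  refine ⟨b j + M • e, add_mem_scoredClosure (hS.mem_scoredClosure j) (nsmul_mem heS M), ?_,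
    fun i hi => ?_⟩
  · rw [add_sub_cancel_left]
    exact nsmul_mem he M
  · by_contra hle
    refine hM M le_rfl i hle ?_
    rwa [sub_add_eq_add_sub]

/-- If the faces `τ i ≻ τ j` with `b i - b j ∈ K τ i` do not intersect in `τ j`, and `τ j` has
codimension at least two, then `D(K[ℕA])` is not left Noetherian. -/
theorem IsStandardExpression.not_isNoetherianRing_diffOp {K : Type*} [Field K] [CharZero K]
    (hA : AddSubgroup.closure (A : Set (Fin d → ℤ)) = ⊤)
    (hS : IsStandardExpression A
      (AddSubmonoid.closure (A : Set (Fin d → ℤ)) : Set (Fin d → ℤ)) b τ)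
    (j : Fin m) (hcodim : 1 < codim (τ j))
    (hinter : (⨅ (i : Fin m) (_ : τ j < τ i)
      (_ : castVec K (b i - b j) ∈ faceSpan K A (τ i)), τ i) ≠ τ j) :
    ¬ IsNoetherianRing (diffOp K
      (AddMonoidAlgebra K (AddSubmonoid.closure (A : Set (Fin d → ℤ))))) := by
  obtain ⟨c, hcA, hcj, hci, H, hH0, hpos, hHj, hHc⟩ := exists_generator hA hS j hcodim hinter
  obtain ⟨h, hhS, hhj, hhi⟩ := exists_generic_hole (K := K) hS j
  have hcS := AddSubmonoid.subset_closure (show c ∈ (A : Set (Fin d → ℤ)) from hcA)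
  obtain ⟨M, hM⟩ := exists_forall_ge_notMem (fun i => faceLattice K A (τ i))
    (fun i => h - b i) (v := c) {i | castVec ℝ c ∉ τ i} fun i hi n hn hc =>
      hi (mem_face_of_mem_faceLattice (hS.isFace i) hcS (faceLattice_saturated hn hc))
  -- If `c ∉ τ i`, the ray has left the coset of `b i` from `M` on. If `c ∈ τ i`, being in the coset
  -- would put `h` there too; then `τ j ≤ τ i`, and the coset of `b j` would be redundant.
  have hray (n : ℕ) (hn : M ≤ n) :
      h + n • c ∈ AddSubmonoid.closure (A : Set (Fin d → ℤ)) := by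
    refine hS.mem_of_forall_notMem (add_mem_scoredClosure hhS (nsmul_mem hcS n)) fun i hi => ?_
    by_cases hciτ : castVec ℝ c ∈ τ i
    · have hij : i ≠ j := by rintro rfl; exact hcj hciτ
      have hc : c ∈ AddSubgroup.closure (restrict A (τ i)) :=
        AddSubgroup.subset_closure ⟨hcA, hciτ⟩
      have hi' : h - b i ∈ AddSubgroup.closure (restrict A (τ i)) := by
        have := sub_mem hi (nsmul_mem hc n)
        rwa [add_sub_right_comm, add_sub_cancel_right] at this
      have hle := hhi i (closure_restrict_le_faceLattice hi')
      refine hS.notMem_of_ne hij hle ?_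
      have := sub_mem hi' (AddSubgroup.closure_mono (restrict_mono hle) hhj)
      rwa [sub_sub_sub_cancel_left] at this
    · refine hM n hn i hciτ ?_
      rw [sub_add_eq_add_sub]
      exact closure_restrict_le_faceLattice hi
  have hwS : ∑ a ∈ A, a ∈ AddSubmonoid.closure (A : Set (Fin d → ℤ)) :=
    sum_mem fun a ha => AddSubmonoid.subset_closure ha
  have hneg {L : (Fin d → ℝ) →ₗ[ℝ] ℝ} (hL0 : L ≠ 0) (hL : ∀ y ∈ cone A, 0 ≤ L y)
      (hLc : L (castVec ℝ c) = 0) (n : ℕ) : L (castVec ℝ (n • c - ∑ a ∈ A, a)) < 0 := by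
    have := pos_of_ne_zero hA hL0 hL
    rw [← castVecHom_apply, map_sub, map_nsmul, map_sub, map_nsmul, castVecHom_apply, hLc,
      smul_zero, zero_sub, castVecHom_apply]
    linarith
  -- Only faces containing `τ j` matter. For `τ i = τ j` the functional `H` serves; for a larger `τ
  -- i`, the choice of `c` gives `c ∈ τ i`, so a supporting functional of `τ i` kills `c`. Either is
  -- negative at `n • c - ∑ a ∈ A, a`.
  have hsep (n : ℕ) := isPolySeparated_of_support (K := K) hA hS hhS
    (x := n • c - ∑ a ∈ A, a) fun i hi => by
      rcases (hhi i hi).eq_or_lt with heq | hlt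
      · exact ⟨H, hpos, heq ▸ hHj, hneg hH0 hpos hHc n⟩
      · obtain ⟨L, hL0, hL, hLi⟩ := exists_support hA (hS.isFace i) (hS.face_ne_cone hA i)
        have hbi : b i - b j ∈ faceLattice K A (τ i) := by
          have := sub_mem (closure_restrict_le_faceLattice (K := K)
            (AddSubgroup.closure_mono (restrict_mono hlt.le) hhj)) hi
          rwa [sub_sub_sub_cancel_left] at this
        exact ⟨L, hL, hLi, hneg hL0 hL (hLi _ (hci i hlt hbi)) n⟩
  -- Spacing by `M + 1` makes `(n - k) * (M + 1) ≥ M` for all `k < n`, so `hray` applies to every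
  -- difference.
  choose p hp hne hvan using fun n : ℕ => hsep (n * (M + 1))
  refine SemigroupDiffOp.not_isNoetherianRing_diffOp (fun n : ℕ => (n * (M + 1)) • c - ∑ a ∈ A, a)
    (hS.notMem_of_mem hhj) hwS (fun n => ?_) (fun k n hkn => ?_) p hp
    (fun n s hs hs' => hvan n s ⟨hs, hs'⟩) hne
  · rw [sub_add_cancel]
    exact nsmul_mem hcS _
  · have := hray ((n - k) * (M + 1)) (by nlinarith [Nat.sub_pos_of_lt hkn])
    convert this using 1
    rw [Nat.sub_mul, sub_nsmul _ (Nat.mul_le_mul_right _ hkn.le)]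
    abel

end StandardExpressions

end SemigroupDiffOp

theorem mainTheorem5 (K : Type*) [Field K] [IsAlgClosed K] [CharZero K] (d : ℕ)
    (A : Finset (Fin d → ℤ))
    (hA : AddSubgroup.closure (A : Set (Fin d → ℤ)) = ⊤)
    (hcone : (SemigroupDiffOp.cone A : ConvexCone ℝ (Fin d → ℝ)).Salient)
    (m : ℕ) (b : Fin m → (Fin d → ℤ)) (τ : Fin m → PointedCone ℝ (Fin d → ℝ))
    (hS : SemigroupDiffOp.IsStandardExpression A
      (AddSubmonoid.closure (A : Set (Fin d → ℤ)) : Set (Fin d → ℤ)) b τ)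
    (j : Fin m) (hcodim : 1 < SemigroupDiffOp.codim (τ j))
    (hinter : (⨅ (i : Fin m) (_ : τ j < τ i)
      (_ : SemigroupDiffOp.castVec K (b i - b j) ∈ SemigroupDiffOp.faceSpan K A (τ i)), τ i)
        ≠ τ j) :
    ¬ IsNoetherianRing (SemigroupDiffOp.diffOp K
      (AddMonoidAlgebra K (AddSubmonoid.closure (A : Set (Fin d → ℤ))))) :=
  hS.not_isNoetherianRing_diffOp hA j hcodim hinter
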